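/- For a real $n\times p$ matrix $X\neq 0$ let $\|X\|$ be its spectral norm, $\|X\|_F$ its Frobenius norm, and $\mathrm{sr}(X)=\|X\|_F^2/\|X\|^2$ its stable rank. Let $\Sigma_k$ be the set of unit vectors $u\in\mathbb{R}^d$ (Euclidean norm) with at most $k$ nonzero coordinates. A family of random variables is called $l$-wise independent if the members of every subfamily of at most $l$ of them are mutually independent. **Theorem.** There are absolute constants $C,c>0$ with the following property. Let $X$ be a nonzero real $n\times p$ matrix, and let $R$ be a random $p\times d$ matrix whose entries are $\lfloor 2\,\mathrm{sr}(X)\rfloor$-wise independent uniform random signs (each entry equals $+1$ and $-1$ with probability $1/2$ each). Let $\varepsilon\in(0,1)$ and let $1\le k\le d$ be an integer such that $$\mathrm{sr}(X)\;\ge\; C\,\frac{k}{\varepsilon^2}\,\max\Big\{1,\log\frac dk\Big\}.$$ (If $d\ge e\,k$, the maximum is $\log(d/k)$.) Then, with probability at least $1-\exp(-c\,\varepsilon^2\,\mathrm{sr}(X))$, the matrix $XR$ satisfies $(k,\varepsilon)$-RIP, that is, $$(1-\varepsilon)\|X\|_F\;\le\;\|XRu\|\;\le\;(1+\varepsilon)\|X\|_F\qquad\text{for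 all }u\in\Sigma_k .$$ -/

import Mathlib

/-- The Frobenius norm `‖X‖_F` of a real matrix. -/
noncomputable def matFrobeniusNorm {n p : ℕ} (X : Matrix (Fin n) (Fin p) ℝ) : ℝ :=
  Real.sqrt (∑ i, ∑ j, X i j ^ 2)

open scoped Matrix.Norms.L2Operator in
/-- The spectral norm `‖X‖`: the operator norm of `X` for the Euclidean norms. -/
noncomputable def matSpectralNorm {n p : ℕ} (X : Matrix (Fin n) (Fin p) ℝ) : ℝ :=
  ‖X‖

/-- The stable rank `sr(X) = ‖X‖_F² / ‖X‖²` (equal to `0` for `X = 0`). -/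
noncomputable def stableRank {n p : ℕ} (X : Matrix (Fin n) (Fin p) ℝ) : ℝ :=
  matFrobeniusNorm X ^ 2 / matSpectralNorm X ^ 2

/-- `Σ_k`: the unit vectors of `ℝ^d` with at most `k` nonzero coordinates. -/
def sparseUnitVectors (d k : ℕ) : Set (EuclideanSpace ℝ (Fin d)) :=
  {u | ‖u‖ = 1 ∧ (Finset.univ.filter fun i => u i ≠ 0).card ≤ k}

/-- The product `X R` satisfies `(k, ε)`-RIP, at the scale `‖X‖_F`: every `u ∈ Σ_k` has
`(1 - ε) ‖X‖_F ≤ ‖X R u‖ ≤ (1 + ε) ‖X‖_F`. -/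
def ProductRIP {n p d : ℕ} (X : Matrix (Fin n) (Fin p) ℝ) (R : Matrix (Fin p) (Fin d) ℝ)
    (k : ℕ) (ε : ℝ) : Prop :=
  ∀ u ∈ sparseUnitVectors d k,
    (1 - ε) * matFrobeniusNorm X ≤ ‖WithLp.toLp 2 ((X * R).mulVec (WithLp.ofLp u))‖ ∧
      ‖WithLp.toLp 2 ((X * R).mulVec (WithLp.ofLp u))‖ ≤ (1 + ε) * matFrobeniusNorm X

/-- `l`-wise independence of a family of real random variables: the members of every subfamily
of at most `l` of them are (mutually) independent. -/
def IsWiseIndep {Ω ι : Type*} [MeasurableSpace Ω] (P : MeasureTheory.Measure Ω) (l : ℕ)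
    (x : ι → Ω → ℝ) : Prop :=
  ∀ S : Finset ι, S.card ≤ l → ProbabilityTheory.iIndepFun (fun (i : S) => x i) P

/-- A uniform random sign: a random variable equal to `1` and to `-1` with probability `1/2`
each. -/
def IsRandomSign {Ω : Type*} [MeasurableSpace Ω] (P : MeasureTheory.Measure Ω)
    (x : Ω → ℝ) : Prop :=
  Measurable x ∧ P {ω | x ω = 1} = 1 / 2 ∧ P {ω | x ω = -1} = 1 / 2

/-! For a unit vector `v`, the square `‖XRv‖²` is a quadratic form in the entries of `R` with mean
`‖X‖_F²`. Its coefficient matrix `productCoeff X v` has Frobenius norm `‖X‖_F` and spectral norm at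
most `‖X‖`. A Hanson–Wright argument thus gives a relative deviation `ε/4` with probability at most
`2 exp(-c ε² sr(X))`.

With fully independent signs, the exponential moment of the centered form
(`signAvg_exp_centeredSqNorm_le`) comes from decoupling followed by Gaussian linearization. With
limited independence that moment is not available, but moments of low order are: the `q`-th power of
the form is a polynomial of degree at most `2q`, so for `2q ≤ l` its expectation agrees with that
under full independence (`integral_eval_eq_signAvg`). There it is controlled by the exponential
moment, and Markov's inequality with `q` proportional to `ε² sr(X)` loses only constants
(`measureReal_fixed_vector_le`).

A union bound over the coordinate subspaces of dimension `k` and over a net of at most `e^{18k}`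
unit vectors in each costs an exponent of order `k max(1, log(d/k))`, which the hypothesis on
`sr(X)` absorbs. A maximizer argument (`abs_shiftedSqNorm_le_of_net`) passes from the nets to all
sparse vectors. -/

/-- The average of `G` over the sign vectors `x ∈ {1, -1}^ι`. -/
noncomputable def signAvg {ι : Type*} [Fintype ι] (G : (ι → ℝ) → ℝ) : ℝ := by
  classical
  exact (2 ^ Fintype.card ι)⁻¹ * ∑ s : ι → ℤˣ, G (fun i => ((s i : ℤ) : ℝ))

/-! ### Averages over the sign cube: the model of fully independent signs. -/

section SignAvg

variable {ι : Type*} [Fintype ι]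

theorem signAvg_eq [DecidableEq ι] (G : (ι → ℝ) → ℝ) :
    signAvg G = (2 ^ Fintype.card ι)⁻¹ * ∑ s : ι → ℤˣ, G (fun i => ((s i : ℤ) : ℝ)) := by
  unfold signAvg
  convert rfl

theorem signAvg_prod (f : ι → ℝ → ℝ) :
    signAvg (fun x => ∏ i, f i (x i)) = ∏ i, ((f i 1 + f i (-1)) / 2) := by
  classical
  rw [signAvg_eq, Finset.prod_div_distrib, Finset.prod_const, Finset.card_univ, div_eq_inv_mul]
  congr 1
  have h := Finset.prod_univ_sum (fun _ : ι => (Finset.univ : Finset ℤˣ))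
    (fun i (s : ℤˣ) => f i ((s : ℤ) : ℝ))
  rw [Fintype.piFinset_univ] at h
  rw [← h]
  refine Finset.prod_congr rfl fun i _ => ?_
  have : (Finset.univ : Finset ℤˣ) = {1, -1} := by decide
  rw [this, Finset.sum_pair (by decide)]
  simp

theorem signAvg_mono {G H : (ι → ℝ) → ℝ}
    (h : ∀ x : ι → ℝ, (∀ i, x i = 1 ∨ x i = -1) → G x ≤ H x) : signAvg G ≤ signAvg H := by
  classical
  rw [signAvg_eq, signAvg_eq]
  refine mul_le_mul_of_nonneg_left (Finset.sum_le_sum fun s _ => h _ fun i => ?_) (by positivity)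
  rcases Int.units_eq_one_or (s i) with h | h <;> simp [h]

theorem signAvg_congr {G H : (ι → ℝ) → ℝ}
    (h : ∀ x : ι → ℝ, (∀ i, x i = 1 ∨ x i = -1) → G x = H x) : signAvg G = signAvg H :=
  le_antisymm (signAvg_mono fun x hx => (h x hx).le) (signAvg_mono fun x hx => (h x hx).ge)

theorem signAvg_const (a : ℝ) : signAvg (fun _ : ι → ℝ => a) = a := by
  classical
  rw [signAvg_eq]
  simp [Fintype.card_units_int]

theorem signAvg_const_mul (a : ℝ) (G : (ι → ℝ) → ℝ) :
    signAvg (fun x => a * G x) = a * signAvg G := by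
  classical
  rw [signAvg_eq, signAvg_eq, ← Finset.mul_sum]
  ring

theorem signAvg_add (G H : (ι → ℝ) → ℝ) :
    signAvg (fun x => G x + H x) = signAvg G + signAvg H := by
  classical
  rw [signAvg_eq, signAvg_eq, signAvg_eq, Finset.sum_add_distrib, mul_add]

theorem signAvg_finset_sum {κ : Type*} (S : Finset κ) (G : κ → (ι → ℝ) → ℝ) :
    signAvg (fun x => ∑ k ∈ S, G k x) = ∑ k ∈ S, signAvg (G k) := by
  classical
  simp_rw [signAvg_eq]
  rw [Finset.sum_comm, Finset.mul_sum]

theorem signAvg_comm {κ : Type*} [Fintype κ] (G : (ι → ℝ) → (κ → ℝ) → ℝ) :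
    signAvg (fun x => signAvg (fun y => G x y)) = signAvg (fun y => signAvg (fun x => G x y)) := by
  classical
  simp_rw [signAvg_eq, ← Finset.mul_sum]
  rw [Finset.sum_comm]
  ring

theorem signAvg_le_const {G : (ι → ℝ) → ℝ} {a : ℝ}
    (h : ∀ x : ι → ℝ, (∀ i, x i = 1 ∨ x i = -1) → G x ≤ a) : signAvg G ≤ a :=
  (signAvg_mono h).trans_eq (signAvg_const a)

/-- Multiplication by `t` permutes the sign cube. In the decoupling step this inserts fresh signs on
part of the coordinates. -/
theorem signAvg_mul_sign (G : (ι → ℝ) → ℝ) (t : ι → ℝ) (ht : ∀ i, t i = 1 ∨ t i = -1) :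
    signAvg (fun x => G (fun i => x i * t i)) = signAvg G := by
  classical
  have : ∀ i, ∃ u : ℤˣ, ((u : ℤ) : ℝ) = t i := by
    intro i
    rcases ht i with h | h
    · exact ⟨1, by simp [h]⟩
    · exact ⟨-1, by simp [h]⟩
  choose u hu using this
  rw [signAvg_eq, signAvg_eq]
  congr 1
  refine Fintype.sum_equiv (Equiv.mulRight u) _ _ fun s => ?_
  congr 1
  funext i
  simp [hu]

theorem exp_signAvg_le (G : (ι → ℝ) → ℝ) :
    Real.exp (signAvg G) ≤ signAvg (fun x => Real.exp (G x)) := by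
  classical
  rw [signAvg_eq, signAvg_eq, Finset.mul_sum, Finset.mul_sum]
  have := convexOn_exp.map_sum_le (t := (Finset.univ : Finset (ι → ℤˣ)))
    (w := fun _ => ((2 : ℝ) ^ Fintype.card ι)⁻¹)
    (p := fun s => G (fun i => ((s i : ℤ) : ℝ)))
    (fun _ _ => by positivity) (by simp [Fintype.card_units_int]) (fun _ _ => Set.mem_univ _)
  simpa [smul_eq_mul] using this

/-- The average factorizes into terms `cosh (a i)`, and `cosh a ≤ exp (a² / 2)`. -/
theorem signAvg_exp_linear_le (a : ι → ℝ) :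
    signAvg (fun x => Real.exp (∑ i, a i * x i)) ≤ Real.exp ((∑ i, a i ^ 2) / 2) := by
  simp_rw [Real.exp_sum]
  rw [signAvg_prod (fun i y => Real.exp (a i * y)), Finset.sum_div, Real.exp_sum]
  refine Finset.prod_le_prod (fun i _ => by positivity) fun i _ => ?_
  have := Real.cosh_le_exp_half_sq (a i)
  rw [Real.cosh_eq] at this
  simpa using this

theorem signAvg_mul_of_ne {e f : ι} (h : e ≠ f) :
    signAvg (fun x : ι → ℝ => x e * x f) = 0 := by
  classical
  have h1 := signAvg_mul_sign (fun x : ι → ℝ => x e * x f) (fun i => if i = e then -1 else 1)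
    (fun i => by by_cases hi : i = e <;> simp [hi])
  have h2 := signAvg_const_mul (-1) (fun x : ι → ℝ => x e * x f)
  simp only [if_true, if_neg h.symm] at h1
  have h3 : signAvg (fun x : ι → ℝ => x e * -1 * (x f * 1)) =
    signAvg (fun x : ι → ℝ => -1 * (x e * x f)) := by congr 1; funext x; ring
  linarith

theorem signAvg_apply (e : ι) : signAvg (fun x : ι → ℝ => x e) = 0 := by
  classical
  have h1 := signAvg_mul_sign (fun x : ι → ℝ => x e) (fun _ => -1) (fun i => by simp)
  have h2 := signAvg_const_mul (-1) (fun x : ι → ℝ => x e)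
  have h3 : signAvg (fun x : ι → ℝ => x e * -1) =
    signAvg (fun x : ι → ℝ => -1 * x e) := by congr 1; funext x; ring
  linarith

/-- The average of `δ_e (1 - δ_f)` for uniform selectors `δ = (1 + t) / 2` is `1/4` off the
diagonal and `0` on it. -/
theorem signAvg_selector [DecidableEq ι] (e f : ι) :
    signAvg (fun t : ι → ℝ => (1 + t e) / 2 * ((1 - t f) / 2)) = if e = f then 0 else 1 / 4 := by
  split_ifs with h
  · subst h
    rw [← signAvg_const (ι := ι) 0]
    refine signAvg_congr fun t ht => ?_
    rcases ht e with h | h <;> simp [h]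
  · have : (fun t : ι → ℝ => (1 + t e) / 2 * ((1 - t f) / 2)) = fun t =>
      1 / 4 + (1 / 4 * t e + (-(1 / 4) * t f + -(1 / 4) * (t e * t f))) := by
      funext t; ring
    rw [this, signAvg_add, signAvg_add, signAvg_add, signAvg_const, signAvg_const_mul,
      signAvg_const_mul, signAvg_const_mul, signAvg_apply, signAvg_apply, signAvg_mul_of_ne h]
    ring

end SignAvg

/-! ### Exponential moments of quadratic forms in independent signs. -/

section QuadraticForm

open MeasureTheory ProbabilityTheory

theorem sum_sq_mulVec {ι κ : Type*} [Fintype ι] [Fintype κ] (M : Matrix κ ι ℝ) (x : ι → ℝ) :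
    ∑ f, (M.mulVec x) f ^ 2 = dotProduct x ((M.transpose * M).mulVec x) := by
  rw [← Matrix.mulVec_mulVec, Matrix.dotProduct_mulVec, Matrix.vecMul_transpose]
  simp [dotProduct, sq]

/-- Orthogonal diagonalization of `x ↦ ‖M x‖²`. -/
theorem exists_orthogonal_diagonalization {ι κ : Type*} [Fintype ι] [Fintype κ]
    (M : Matrix κ ι ℝ) {K : ℝ} (hK : ∀ x : ι → ℝ, ∑ f, (M.mulVec x) f ^ 2 ≤ K * ∑ e, x e ^ 2) :
    ∃ (U : Matrix ι ι ℝ) (l : ι → ℝ), (∀ i, 0 ≤ l i ∧ l i ≤ K) ∧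
      ∑ i, l i = ∑ f, ∑ e, M f e ^ 2 ∧
      (∀ x : ι → ℝ, ∑ f, (M.mulVec x) f ^ 2 = ∑ i, l i * (U.transpose.mulVec x) i ^ 2) ∧
      ∀ g : ι → ℝ, ∑ e, (U.mulVec g) e ^ 2 = ∑ i, g i ^ 2 := by
  classical
  have hH : (M.transpose * M).IsHermitian := by
    rw [Matrix.IsHermitian, Matrix.conjTranspose_eq_transpose_of_trivial, Matrix.transpose_mul,
      Matrix.transpose_transpose]
  set U : Matrix ι ι ℝ := (hH.eigenvectorUnitary).1 with hU
  have hU1 : U.transpose * U = 1 := by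
    have := Unitary.coe_star_mul_self hH.eigenvectorUnitary
    rwa [Matrix.star_eq_conjTranspose, Matrix.conjTranspose_eq_transpose_of_trivial] at this
  have hU2 : U * U.transpose = 1 := mul_eq_one_comm.mp hU1
  have hD : U.transpose * (M.transpose * M) * U = Matrix.diagonal hH.eigenvalues := by
    have h1 : (M.transpose * M) * U = U * Matrix.diagonal hH.eigenvalues := by
      ext i j
      have := congrFun (hH.mulVec_eigenvectorBasis j) i
      rw [Matrix.mul_diagonal]
      simpa [Matrix.mul_apply, Matrix.mulVec, dotProduct, hU, mul_comm] using this
    rw [mul_assoc, h1, ← mul_assoc, hU1, one_mul]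
  have hquad : ∀ x : ι → ℝ,
      ∑ f, (M.mulVec x) f ^ 2 = ∑ i, hH.eigenvalues i * (U.transpose.mulVec x) i ^ 2 := by
    intro x
    have hA : M.transpose * M = U * Matrix.diagonal hH.eigenvalues * U.transpose := by
      rw [← hD]
      calc M.transpose * M = (U * U.transpose) * (M.transpose * M) * (U * U.transpose) := by
            rw [hU2, one_mul, mul_one]
        _ = _ := by simp only [mul_assoc]
    rw [sum_sq_mulVec]
    generalize hH.eigenvalues = lam at hA ⊢
    rw [hA, mul_assoc, ← Matrix.mulVec_mulVec, Matrix.dotProduct_mulVec,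
      ← Matrix.mulVec_transpose, ← Matrix.mulVec_mulVec, dotProduct]
    refine Finset.sum_congr rfl fun i _ => ?_
    rw [Matrix.mulVec_diagonal]
    ring
  have hiso : ∀ g : ι → ℝ, ∑ e, (U.mulVec g) e ^ 2 = ∑ i, g i ^ 2 := by
    intro g
    rw [sum_sq_mulVec, hU1, Matrix.one_mulVec]
    simp [dotProduct, sq]
  -- Each eigenvalue is the value of the form at a unit eigenvector, hence lies in `[0, K]`.
  have hl : ∀ i, hH.eigenvalues i = ∑ f, (M.mulVec (U.mulVec (Pi.single i 1))) f ^ 2 := by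
    intro i
    rw [hquad, Matrix.mulVec_mulVec, hU1, Matrix.one_mulVec, Finset.sum_eq_single i]
    · simp
    · intro j _ hj
      simp [hj]
    · simp
  refine ⟨U, hH.eigenvalues, fun i => ⟨?_, ?_⟩, ?_, hquad, hiso⟩
  · rw [hl]
    positivity
  · rw [hl]
    refine (hK _).trans_eq ?_
    rw [hiso, Finset.sum_eq_single i]
    · simp
    · intro j _ hj
      simp [hj]
    · simp
  · rw [← Matrix.trace_diagonal, ← hD, Matrix.trace_mul_cycle, hU2, one_mul, Matrix.trace,
      Finset.sum_comm]
    simp [Matrix.mul_apply, sq]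

theorem integrable_exp_mul_sq_gaussianReal {t : ℝ} (ht : t < 1 / 2) :
    Integrable (fun x : ℝ => Real.exp (t * x ^ 2)) (gaussianReal 0 1) := by
  rw [gaussianReal_of_var_ne_zero _ one_ne_zero,
    integrable_withDensity_iff (measurable_gaussianPDF _ _)
      (Filter.Eventually.of_forall fun _ => gaussianPDF_lt_top)]
  have h := (integrable_exp_neg_mul_sq (b := 1 / 2 - t) (by linarith)).mul_const
    (√(2 * Real.pi * (1 : NNReal)))⁻¹
  refine h.congr (Filter.Eventually.of_forall fun x => ?_)
  simp only [toReal_gaussianPDF, gaussianPDFReal_def]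
  rw [mul_left_comm, ← Real.exp_add, mul_comm]
  congr 2
  push_cast
  ring

/-- The integral equals `(1 - 2t)^(-1/2)`, and `(1 - 2t)(1 + 4t) ≥ 1` exactly because `0 ≤ t ≤ 1/4`.
-/
theorem integral_exp_mul_sq_gaussianReal_le {t : ℝ} (ht0 : 0 ≤ t) (ht : t ≤ 1 / 4) :
    ∫ x, Real.exp (t * x ^ 2) ∂gaussianReal 0 1 ≤ Real.exp (2 * t) := by
  have h1 : ∫ x, Real.exp (t * x ^ 2) ∂gaussianReal 0 1 = √(1 / (1 - 2 * t)) := by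
    rw [integral_gaussianReal_eq_integral_smul one_ne_zero]
    have : ∀ x : ℝ, gaussianPDFReal 0 1 x • Real.exp (t * x ^ 2) =
        (√(2 * Real.pi))⁻¹ * Real.exp (-(1 / 2 - t) * x ^ 2) := by
      intro x
      rw [gaussianPDFReal_def, smul_eq_mul, mul_assoc, ← Real.exp_add]
      simp only [NNReal.coe_one, mul_one]
      congr 2
      ring
    simp_rw [this]
    rw [integral_const_mul, integral_gaussian, ← Real.sqrt_inv, ← Real.sqrt_mul (by positivity)]
    congr 1
    have : (1 / 2 - t) ≠ 0 := by linarith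
    have : (1 - 2 * t) ≠ 0 := by linarith
    field_simp
  rw [h1]
  refine Real.sqrt_le_iff.2 ⟨by positivity, ?_⟩
  rw [← Real.exp_nat_mul, div_le_iff₀ (by linarith)]
  have h2 : 1 + 4 * t ≤ Real.exp (4 * t) := by linarith [Real.add_one_le_exp (4 * t)]
  have h3 : ((2 : ℕ) : ℝ) * (2 * t) = 4 * t := by push_cast; ring
  rw [h3]
  nlinarith

theorem integral_exp_mul_gaussianReal (a : ℝ) :
    ∫ x, Real.exp (a * x) ∂gaussianReal 0 1 = Real.exp (a ^ 2 / 2) := by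
  have := congrFun (mgf_fun_id_gaussianReal (μ := 0) (v := 1)) a
  simpa [mgf] using this

/-- Exponential moments of `‖M x‖²` for a random sign vector `x`. -/
theorem signAvg_exp_sum_sq_mulVec_le {ι κ : Type*} [Fintype ι] [Fintype κ] (M : Matrix κ ι ℝ)
    {K μ : ℝ} (hK : ∀ x : ι → ℝ, ∑ f, (M.mulVec x) f ^ 2 ≤ K * ∑ e, x e ^ 2)
    (hμ : 0 ≤ μ) (hμK : μ * K ≤ 1 / 4) :
    signAvg (fun x => Real.exp (μ * ∑ f, (M.mulVec x) f ^ 2)) ≤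
      Real.exp (2 * μ * ∑ f, ∑ e, M f e ^ 2) := by
  classical
  obtain ⟨U, l, hl, hsum, hquad, hiso⟩ := exists_orthogonal_diagonalization M hK
  set γ : Measure (ι → ℝ) := Measure.pi fun _ => gaussianReal 0 1
  -- Since `E exp (b g) = exp (b² / 2)` for a standard Gaussian `g`, the weight `√(2 μ l i)` turns
  -- each factor `exp (μ l_i z_i²)` into the Gaussian average of an exponential linear in `x`.
  set a : ι → ℝ := fun i => √(2 * μ * l i) with ha
  have ha2 : ∀ i, a i ^ 2 = 2 * μ * l i := fun i => Real.sq_sqrt (by have := (hl i).1; positivity)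
  have hlin : ∀ x : ι → ℝ, Real.exp (μ * ∑ f, (M.mulVec x) f ^ 2) =
      ∫ g, ∏ i, Real.exp (a i * (U.transpose.mulVec x) i * g i) ∂γ := by
    intro x
    rw [integral_fintype_prod_eq_prod
      (f := fun i y => Real.exp (a i * (U.transpose.mulVec x) i * y))]
    simp_rw [integral_exp_mul_gaussianReal]
    rw [← Real.exp_sum, hquad, Finset.mul_sum]
    congr 1
    refine Finset.sum_congr rfl fun i _ => ?_
    rw [mul_pow, ha2]
    ring
  have hint : ∀ x : ι → ℝ,
      Integrable (fun g : ι → ℝ => ∏ i, Real.exp (a i * (U.transpose.mulVec x) i * g i)) γ :=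
    fun x => Integrable.fintype_prod
      (f := fun i y => Real.exp (a i * (U.transpose.mulVec x) i * y))
      fun i => integrable_exp_mul_gaussianReal _
  have hμl : ∀ i, μ * l i ≤ 1 / 4 := fun i => (mul_le_mul_of_nonneg_left (hl i).2 hμ).trans hμK
  calc signAvg (fun x => Real.exp (μ * ∑ f, (M.mulVec x) f ^ 2))
      = ∫ g, signAvg (fun x => ∏ i, Real.exp (a i * (U.transpose.mulVec x) i * g i)) ∂γ := by
        simp_rw [hlin, signAvg_eq]
        rw [integral_const_mul, integral_finsetSum _ fun s _ => hint _]
    -- With `g` fixed the exponent is linear in the signs, so the subgaussian bound applies; `U`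
    -- being an isometry, only `∑ a_i² g_i² / 2` remains.
    _ ≤ ∫ g, ∏ i, Real.exp (μ * l i * g i ^ 2) ∂γ := by
        refine integral_mono ?_ ?_ fun g => ?_
        · simp_rw [signAvg_eq]
          exact (integrable_finsetSum _ fun s _ => hint _).const_mul _
        · exact Integrable.fintype_prod (f := fun i y => Real.exp (μ * l i * y ^ 2))
            fun i => integrable_exp_mul_sq_gaussianReal (by linarith [hμl i])
        · simp only
          have h1 : ∀ x : ι → ℝ, ∏ i, Real.exp (a i * (U.transpose.mulVec x) i * g i) =
              Real.exp (∑ e, (U.mulVec fun i => a i * g i) e * x e) := by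
            intro x
            rw [← Real.exp_sum]
            congr 1
            simp only [Matrix.mulVec, dotProduct, Matrix.transpose_apply, Finset.mul_sum,
              Finset.sum_mul]
            rw [Finset.sum_comm]
            refine Finset.sum_congr rfl fun i _ => Finset.sum_congr rfl fun e _ => ?_
            ring
          simp_rw [h1]
          refine (signAvg_exp_linear_le _).trans_eq ?_
          rw [hiso, ← Real.exp_sum, Finset.sum_div]
          congr 1
          refine Finset.sum_congr rfl fun i _ => ?_
          rw [mul_pow, ha2]
          ring
    _ = ∏ i, ∫ y, Real.exp (μ * l i * y ^ 2) ∂gaussianReal 0 1 :=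
        integral_fintype_prod_eq_prod (f := fun i y => Real.exp (μ * l i * y ^ 2))
    _ ≤ ∏ i, Real.exp (2 * (μ * l i)) := by
        refine Finset.prod_le_prod (fun i _ => integral_nonneg fun _ => (Real.exp_pos _).le)
          fun i _ => ?_
        exact integral_exp_mul_sq_gaussianReal_le (mul_nonneg hμ (hl i).1) (hμl i)
    _ = _ := by
        rw [← Real.exp_sum, ← hsum, Finset.mul_sum]
        simp_rw [mul_assoc]

/-- Exponential moments of the off-diagonal chaos of order two in random signs. -/
theorem signAvg_exp_offDiag_le {ι : Type*} [Fintype ι] [DecidableEq ι] (B : Matrix ι ι ℝ)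
    {K l : ℝ} (hK : ∀ x : ι → ℝ, ∑ f, (B.mulVec x) f ^ 2 ≤ K * ∑ e, x e ^ 2) (hK0 : 0 ≤ K)
    (hl : 32 * l ^ 2 * K ≤ 1) :
    signAvg (fun x => Real.exp (l * ∑ f, ∑ e, if e = f then 0 else B f e * x e * x f)) ≤
      Real.exp (16 * l ^ 2 * ∑ f, ∑ e, B f e ^ 2) := by
  -- Decoupling: `t` splits the coordinates in two, and `M t` keeps the block of `B` with columns in
  -- `{t = 1}` and rows in `{t = -1}`. Each off-diagonal entry survives with frequency `1/4`, whence
  -- the factor `4` below.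
  set M : (ι → ℝ) → Matrix ι ι ℝ :=
    fun t => Matrix.of fun f e => (1 - t f) / 2 * ((1 + t e) / 2) * B f e with hM
  have hdec : ∀ x : ι → ℝ, l * ∑ f, ∑ e, (if e = f then 0 else B f e * x e * x f) =
      signAvg (fun t => 4 * l * ∑ f, x f * ((M t).mulVec x) f) := by
    intro x
    rw [signAvg_const_mul, signAvg_finset_sum, mul_comm 4 l, mul_assoc]
    congr 1
    rw [Finset.mul_sum]
    refine Finset.sum_congr rfl fun f _ => ?_
    have : ∀ t : ι → ℝ, x f * ((M t).mulVec x) f =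
        ∑ e, B f e * x e * x f * ((1 + t e) / 2 * ((1 - t f) / 2)) := by
      intro t
      simp only [hM, Matrix.mulVec, dotProduct, Matrix.of_apply, Finset.mul_sum]
      refine Finset.sum_congr rfl fun e _ => ?_
      ring
    simp_rw [this]
    rw [signAvg_finset_sum, Finset.mul_sum]
    refine Finset.sum_congr rfl fun e _ => ?_
    rw [signAvg_const_mul, signAvg_selector]
    split_ifs <;> ring
  have hsel : ∀ t : ι → ℝ, (∀ i, t i = 1 ∨ t i = -1) →
      signAvg (fun x => Real.exp (4 * l * ∑ f, x f * ((M t).mulVec x) f)) ≤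
        Real.exp (16 * l ^ 2 * ∑ f, ∑ e, B f e ^ 2) := by
    intro t ht
    -- Fresh signs are inserted only on the row block `{t = -1}`. As `M t` reads `x` only on `{t =
    -- 1}`, they leave `(M t) x` unchanged, and the form becomes linear in `y`.
    set y' : (ι → ℝ) → ι → ℝ := fun y f => if t f = 1 then 1 else y f with hy'
    have hy1 : ∀ y : ι → ℝ, (∀ i, y i = 1 ∨ y i = -1) → ∀ i, y' y i = 1 ∨ y' y i = -1 := by
      intro y hy i
      by_cases h : t i = 1 <;> simp [hy', h, hy i]
    have hMy : ∀ x y : ι → ℝ, ∑ f, x f * y' y f * ((M t).mulVec fun i => x i * y' y i) f =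
        ∑ f, (x f * ((M t).mulVec x) f) * y f := by
      intro x y
      refine Finset.sum_congr rfl fun f _ => ?_
      have h1 : ((M t).mulVec fun i => x i * y' y i) f = ((M t).mulVec x) f := by
        simp only [Matrix.mulVec, dotProduct]
        refine Finset.sum_congr rfl fun e _ => ?_
        rcases ht e with h | h <;> simp [hM, hy', h]
      rw [h1]
      rcases ht f with h | h
      · have : ((M t).mulVec x) f = 0 := by
          simp [Matrix.mulVec, dotProduct, hM, h]
        rw [this]
        ring
      · have : y' y f = y f := by
          simp only [hy', h]
          norm_num
        rw [this]
        ring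
    have hKM : ∀ x : ι → ℝ, ∑ f, ((M t).mulVec x) f ^ 2 ≤ K * ∑ e, x e ^ 2 := by
      intro x
      calc ∑ f, ((M t).mulVec x) f ^ 2
          ≤ ∑ f, (B.mulVec fun e => (1 + t e) / 2 * x e) f ^ 2 := by
            refine Finset.sum_le_sum fun f _ => ?_
            have : ((M t).mulVec x) f =
                (1 - t f) / 2 * (B.mulVec fun e => (1 + t e) / 2 * x e) f := by
              simp only [hM, Matrix.mulVec, dotProduct, Matrix.of_apply, Finset.mul_sum]
              refine Finset.sum_congr rfl fun e _ => ?_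
              ring
            rw [this]
            rcases ht f with h | h
            · rw [h]
              norm_num
              exact sq_nonneg _
            · rw [h]
              norm_num
        _ ≤ K * ∑ e, ((1 + t e) / 2 * x e) ^ 2 := hK _
        _ ≤ K * ∑ e, x e ^ 2 := by
            refine mul_le_mul_of_nonneg_left (Finset.sum_le_sum fun e _ => ?_) hK0
            rcases ht e with h | h
            · rw [h]
              norm_num
            · rw [h]
              norm_num
              exact sq_nonneg _
    calc signAvg (fun x => Real.exp (4 * l * ∑ f, x f * ((M t).mulVec x) f))
        = signAvg (fun y : ι → ℝ => signAvg (fun x =>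
            Real.exp (4 * l * ∑ f, x f * ((M t).mulVec x) f))) := (signAvg_const _).symm
      _ = signAvg (fun y : ι → ℝ => signAvg (fun x => Real.exp
            (4 * l * ∑ f, x f * y' y f * ((M t).mulVec fun i => x i * y' y i) f))) :=
          signAvg_congr fun y hy => (signAvg_mul_sign
            (fun x => Real.exp (4 * l * ∑ f, x f * ((M t).mulVec x) f)) _ (hy1 y hy)).symm
      _ = signAvg (fun x : ι → ℝ => signAvg (fun y => Real.exp
            (∑ f, (4 * l * (x f * ((M t).mulVec x) f)) * y f))) := by
          rw [signAvg_comm]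
          simp_rw [hMy, Finset.mul_sum, mul_assoc]
      _ ≤ signAvg (fun x : ι → ℝ => Real.exp (8 * l ^ 2 * ∑ f, ((M t).mulVec x) f ^ 2)) := by
          refine signAvg_mono fun x hx => (signAvg_exp_linear_le _).trans_eq ?_
          rw [Finset.sum_div, Finset.mul_sum]
          congr 1
          refine Finset.sum_congr rfl fun f _ => ?_
          have : x f ^ 2 = 1 := by rcases hx f with h | h <;> simp [h]
          rw [mul_pow, mul_pow, mul_pow, this]
          ring
      -- Here `μ = 8 l²`, so the requirement `μ K ≤ 1/4` is the hypothesis `32 l² K ≤ 1`.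
      _ ≤ Real.exp (2 * (8 * l ^ 2) * ∑ f, ∑ e, M t f e ^ 2) :=
          signAvg_exp_sum_sq_mulVec_le _ hKM (by positivity) (by linarith)
      _ ≤ _ := by
          refine Real.exp_le_exp.2 ?_
          rw [← mul_assoc, show (2 : ℝ) * 8 = 16 by norm_num]
          refine mul_le_mul_of_nonneg_left (Finset.sum_le_sum fun f _ =>
            Finset.sum_le_sum fun e _ => ?_) (by positivity)
          rcases ht f with h | h <;> rcases ht e with h' | h' <;> simp [hM, h, h'] <;>
            positivity
  calc _ = signAvg (fun x => Real.exp (signAvg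
          (fun t => 4 * l * ∑ f, x f * ((M t).mulVec x) f))) := by simp_rw [hdec]
    _ ≤ signAvg (fun x => signAvg (fun t =>
          Real.exp (4 * l * ∑ f, x f * ((M t).mulVec x) f))) :=
        signAvg_mono fun x _ => exp_signAvg_le _
    _ = signAvg (fun t => signAvg (fun x =>
          Real.exp (4 * l * ∑ f, x f * ((M t).mulVec x) f))) := signAvg_comm _
    _ ≤ _ := signAvg_le_const hsel

end QuadraticForm

/-! ### From full independence to `l`-wise independence, through moments. -/

section RandomSigns

open MeasureTheory ProbabilityTheory

variable {Ω ι : Type*} [MeasurableSpace Ω] {P : Measure Ω} [IsProbabilityMeasure P]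

theorem IsRandomSign.ae_eq {x : Ω → ℝ} (h : IsRandomSign P x) : ∀ᵐ ω ∂P, x ω = 1 ∨ x ω = -1 := by
  obtain ⟨hm, h1, h2⟩ := h
  have hA : MeasurableSet {ω | x ω = 1} := hm (measurableSet_singleton 1)
  have hB : MeasurableSet {ω | x ω = -1} := hm (measurableSet_singleton (-1))
  have hd : Disjoint {ω | x ω = 1} {ω | x ω = -1} := by
    rw [Set.disjoint_left]
    intro ω h h'
    simp only [Set.mem_ofPred_eq] at h h'
    linarith
  have hu : P ({ω | x ω = 1} ∪ {ω | x ω = -1}) = 1 := by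
    rw [measure_union hd hB, h1, h2, ENNReal.add_halves]
  exact (prob_compl_eq_zero_iff (hA.union hB)).2 hu

theorem IsRandomSign.integral_comp {x : Ω → ℝ} (h : IsRandomSign P x) (f : ℝ → ℝ) :
    ∫ ω, f (x ω) ∂P = (f 1 + f (-1)) / 2 := by
  have hA : MeasurableSet {ω | x ω = 1} := h.1 (measurableSet_singleton 1)
  have hB : MeasurableSet {ω | x ω = -1} := h.1 (measurableSet_singleton (-1))
  have h1 : (fun ω => f (x ω)) =ᵐ[P] fun ω =>
      {ω | x ω = 1}.indicator (fun _ => f 1) ω + {ω | x ω = -1}.indicator (fun _ => f (-1)) ω := by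
    filter_upwards [h.ae_eq] with ω hω
    rcases hω with hω | hω <;> simp [Set.indicator, hω] <;> norm_num
  rw [integral_congr_ae h1, integral_add ((integrable_const _).indicator hA)
    ((integrable_const _).indicator hB), integral_indicator_const _ hA,
    integral_indicator_const _ hB, measureReal_def, measureReal_def, h.2.1, h.2.2]
  simp
  ring

theorem integrable_prod_pow_of_isRandomSign {x : ι → Ω → ℝ} (hx : ∀ i, IsRandomSign P (x i))
    (S : Finset ι) (m : ι → ℕ) : Integrable (fun ω => ∏ i ∈ S, x i ω ^ m i) P := by
  refine Integrable.of_bound (C := 1)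
    (Finset.measurable_prod _ fun i _ => (hx i).1.pow_const _).aestronglyMeasurable ?_
  have : ∀ᵐ ω ∂P, ∀ i ∈ S, x i ω = 1 ∨ x i ω = -1 :=
    (Finset.eventually_all S).2 fun i _ => (hx i).ae_eq
  filter_upwards [this] with ω hω
  rw [norm_prod]
  refine (Finset.prod_eq_one fun i hi => ?_).le
  rcases hω i hi with h | h <;> simp [h]

/-- Under `l`-wise independence, polynomials of degree at most `l` in random signs have the same
expectation as under full independence. -/
theorem integral_eval_eq_signAvg [Fintype ι] {l : ℕ} {x : ι → Ω → ℝ}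
    (hx : ∀ i, IsRandomSign P (x i)) (hind : IsWiseIndep P l x) (F : MvPolynomial ι ℝ)
    (hF : F.totalDegree ≤ l) :
    ∫ ω, MvPolynomial.eval (fun i => x i ω) F ∂P = signAvg fun y => MvPolynomial.eval y F := by
  classical
  simp_rw [MvPolynomial.eval_eq]
  rw [integral_finsetSum _ fun d _ => (integrable_prod_pow_of_isRandomSign hx _ _).const_mul _,
    signAvg_finset_sum]
  refine Finset.sum_congr rfl fun d hd => ?_
  rw [integral_const_mul, signAvg_const_mul]
  congr 1
  -- A monomial of degree at most `l` involves at most `l` of the variables, so its expectation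
  -- factorizes.
  have hcard : d.support.card ≤ l := by
    refine le_trans ?_ ((MvPolynomial.le_totalDegree hd).trans hF)
    rw [Finset.card_eq_sum_ones]
    exact Finset.sum_le_sum fun i hi => Nat.one_le_iff_ne_zero.2 (Finsupp.mem_support_iff.1 hi)
  have h1 : ∀ ω, ∏ i ∈ d.support, x i ω ^ d i = ∏ i : d.support, x i ω ^ d i := fun ω =>
    (Finset.prod_coe_sort d.support fun i => x i ω ^ d i).symm
  simp_rw [h1]
  rw [(hind d.support hcard).integral_fun_prod_comp (f := fun (i : d.support) y => y ^ d i)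
    (fun i => (hx i).1.aemeasurable)
    (fun i => (measurable_id.pow_const _).aestronglyMeasurable)]
  simp_rw [fun i : d.support => (hx i).integral_comp (fun y => y ^ d i)]
  have h2 : ∀ y : ι → ℝ, ∏ i ∈ d.support, y i ^ d i = ∏ i, y i ^ d i := fun y =>
    Finset.prod_subset (Finset.subset_univ _) fun i _ hi => by
      rw [Finsupp.notMem_support_iff.1 hi, pow_zero]
  simp_rw [h2]
  rw [signAvg_prod (fun i y => y ^ d i),
    Finset.prod_coe_sort d.support (fun i => ((1 : ℝ) ^ d i + (-1) ^ d i) / 2)]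
  refine Finset.prod_subset (Finset.subset_univ _) fun i _ hi => by
    rw [Finsupp.notMem_support_iff.1 hi]
    norm_num

theorem integrable_eval_of_isRandomSign {x : ι → Ω → ℝ}
    (hx : ∀ i, IsRandomSign P (x i)) (F : MvPolynomial ι ℝ) :
    Integrable (fun ω => MvPolynomial.eval (fun i => x i ω) F) P := by
  simp_rw [MvPolynomial.eval_eq]
  exact integrable_finsetSum _ fun d _ => (integrable_prod_pow_of_isRandomSign hx _ _).const_mul _

/-- The quantity `|l y|^q / q!` is a single term of the series of `exp |l y|`. -/
theorem even_pow_le_factorial_mul_exp {q : ℕ} (hq : Even q) {l : ℝ} (hl : 0 < l) (y : ℝ) :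
    y ^ q ≤ q.factorial / l ^ q * (Real.exp (l * y) + Real.exp (-l * y)) := by
  have h1 := Real.pow_div_factorial_le_exp _ (abs_nonneg (l * y)) q
  have h2 : Real.exp |l * y| ≤ Real.exp (l * y) + Real.exp (-l * y) := by
    rcases abs_cases (l * y) with ⟨h, _⟩ | ⟨h, _⟩
    · rw [h]
      linarith [Real.exp_pos (-l * y)]
    · rw [h, ← neg_mul]
      linarith [Real.exp_pos (l * y)]
  rw [hq.pow_abs, mul_pow] at h1
  have h3 : (0 : ℝ) < q.factorial := by exact_mod_cast q.factorial_pos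
  rw [div_mul_eq_mul_div, le_div_iff₀ (by positivity)]
  rw [div_le_iff₀ h3] at h1
  nlinarith

/-- Tail bound from a two-sided exponential moment under full independence, using only moments
of order `q`. -/
theorem measureReal_le_abs_eval_le [Fintype ι] {l q : ℕ} {x : ι → Ω → ℝ}
    (hx : ∀ i, IsRandomSign P (x i)) (hind : IsWiseIndep P l x) (G : MvPolynomial ι ℝ)
    (hG : G.totalDegree ≤ 2) (hq : Even q) (hql : 2 * q ≤ l) {t τ M : ℝ} (ht : 0 < t)
    (hτ : 0 < τ)
    (h1 : signAvg (fun y => Real.exp (t * MvPolynomial.eval y G)) ≤ M)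
    (h2 : signAvg (fun y => Real.exp (-t * MvPolynomial.eval y G)) ≤ M) :
    P.real {ω | τ ≤ |MvPolynomial.eval (fun i => x i ω) G|} ≤
      (q / (t * τ)) ^ q * (2 * M) := by
  -- `G ^ q` has degree at most `2q ≤ l`, so its expectation can be computed over the sign cube,
  -- where exponential moments are available.
  have hmom : ∫ ω, (MvPolynomial.eval (fun i => x i ω) G) ^ q ∂P ≤
      q.factorial / t ^ q * (2 * M) := by
    have h3 := integral_eval_eq_signAvg hx hind (G ^ q)
      (((MvPolynomial.totalDegree_pow G q).trans (by nlinarith)).trans hql)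
    simp only [map_pow] at h3
    rw [h3]
    refine (signAvg_mono fun y _ => even_pow_le_factorial_mul_exp hq ht _).trans ?_
    rw [signAvg_const_mul, signAvg_add]
    exact mul_le_mul_of_nonneg_left (by linarith) (by positivity)
  have hint : Integrable (fun ω => (MvPolynomial.eval (fun i => x i ω) G) ^ q) P := by
    simpa only [map_pow] using integrable_eval_of_isRandomSign hx (G ^ q)
  have hmk := mul_meas_ge_le_integral_of_nonneg
    (Filter.Eventually.of_forall fun ω => hq.pow_nonneg (MvPolynomial.eval (fun i => x i ω) G))
    hint (τ ^ q)
  have hsub : P.real {ω | τ ≤ |MvPolynomial.eval (fun i => x i ω) G|} ≤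
      P.real {ω | τ ^ q ≤ (MvPolynomial.eval (fun i => x i ω) G) ^ q} := by
    refine measureReal_mono fun ω hω => ?_
    simp only [Set.mem_ofPred_eq] at hω ⊢
    rw [← hq.pow_abs (MvPolynomial.eval _ G)]
    exact pow_le_pow_left₀ hτ.le hω q
  have hM : 0 ≤ 2 * M := by
    have : 0 ≤ M := le_trans (by
      rw [← signAvg_const (ι := ι) 0]
      exact signAvg_mono fun y _ => (Real.exp_pos _).le) h1
    linarith
  have hfact : (q.factorial : ℝ) ≤ (q : ℝ) ^ q := by exact_mod_cast q.factorial_le_pow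
  calc P.real {ω | τ ≤ |MvPolynomial.eval (fun i => x i ω) G|}
      ≤ (q.factorial / t ^ q * (2 * M)) / τ ^ q := by
        rw [le_div_iff₀ (by positivity)]
        nlinarith [pow_pos hτ q]
    _ = q.factorial / (t * τ) ^ q * (2 * M) := by
        rw [mul_pow]
        field_simp
    _ ≤ (q : ℝ) ^ q / (t * τ) ^ q * (2 * M) := by gcongr
    _ = _ := by rw [div_pow]

end RandomSigns

/-! ### Concentration of `‖XRv‖²` for one unit vector. -/

section HansonWright

open MeasureTheory ProbabilityTheory

theorem sum_sq_transpose_mulVec_le {ι κ : Type*} [Fintype ι] [Fintype κ] {Y : Matrix κ ι ℝ} {K : ℝ}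
    (hK0 : 0 ≤ K) (hK : ∀ x : ι → ℝ, ∑ i, (Y.mulVec x) i ^ 2 ≤ K * ∑ e, x e ^ 2) (z : κ → ℝ) :
    ∑ e, (Y.transpose.mulVec z) e ^ 2 ≤ K * ∑ i, z i ^ 2 := by
  set W := ∑ e, (Y.transpose.mulVec z) e ^ 2 with hW
  have hW0 : 0 ≤ W := by positivity
  have h1 : W = ∑ i, z i * (Y.mulVec (Y.transpose.mulVec z)) i := by
    rw [hW, sum_sq_mulVec, Matrix.transpose_transpose, Matrix.mulVec_mulVec, dotProduct]
  -- By Cauchy–Schwarz and the bound on `Y`; cancelling one factor `W` gives the claim.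
  have h2 : W ^ 2 ≤ (∑ i, z i ^ 2) * (K * W) := by
    calc W ^ 2 = (∑ i, z i * (Y.mulVec (Y.transpose.mulVec z)) i) ^ 2 := by rw [← h1]
      _ ≤ (∑ i, z i ^ 2) * ∑ i, (Y.mulVec (Y.transpose.mulVec z)) i ^ 2 :=
        Finset.sum_mul_sq_le_sq_mul_sq _ _ _
      _ ≤ _ := mul_le_mul_of_nonneg_left (hK _) (by positivity)
  rcases hW0.eq_or_lt with h | h
  · rw [← h]
    positivity
  · nlinarith

/-- The polynomial `‖Y x‖² - ‖Y‖_F²` in the coordinates of `x`. -/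
noncomputable def centeredSqNormPoly {ι κ : Type*} [Fintype ι] [Fintype κ] (Y : Matrix κ ι ℝ) :
    MvPolynomial ι ℝ :=
  ∑ i, (∑ e, MvPolynomial.C (Y i e) * MvPolynomial.X e) ^ 2 -
    MvPolynomial.C (∑ i, ∑ e, Y i e ^ 2)

variable {ι κ : Type*} [Fintype ι] [Fintype κ]

theorem eval_centeredSqNormPoly (Y : Matrix κ ι ℝ) (x : ι → ℝ) :
    MvPolynomial.eval x (centeredSqNormPoly Y) =
      ∑ i, (Y.mulVec x) i ^ 2 - ∑ i, ∑ e, Y i e ^ 2 := by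
  simp [centeredSqNormPoly, Matrix.mulVec, dotProduct]

theorem totalDegree_centeredSqNormPoly_le (Y : Matrix κ ι ℝ) :
    (centeredSqNormPoly Y).totalDegree ≤ 2 := by
  refine (MvPolynomial.totalDegree_sub _ _).trans
    (max_le ?_ ((MvPolynomial.totalDegree_C _).le.trans (Nat.zero_le 2)))
  refine MvPolynomial.totalDegree_finsetSum_le fun i _ =>
    (MvPolynomial.totalDegree_pow _ _).trans ?_
  have : (∑ e, MvPolynomial.C (Y i e) * MvPolynomial.X e : MvPolynomial ι ℝ).totalDegree ≤ 1 :=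
    MvPolynomial.totalDegree_finsetSum_le fun e _ =>
      (MvPolynomial.totalDegree_mul _ _).trans (by simp)
  omega

/-- On sign vectors `x f ^ 2 = 1`, so the diagonal of the form is the constant `‖Y‖_F²`, which the
centering removes. -/
theorem eval_centeredSqNormPoly_eq_offDiag [DecidableEq ι] (Y : Matrix κ ι ℝ) {x : ι → ℝ}
    (hx : ∀ i, x i = 1 ∨ x i = -1) :
    MvPolynomial.eval x (centeredSqNormPoly Y) =
      ∑ f, ∑ e, if e = f then 0 else (Y.transpose * Y) f e * x e * x f := by
  have hx2 : ∀ i, x i ^ 2 = 1 := fun i => by rcases hx i with h | h <;> simp [h]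
  have hdiag : ∑ i, ∑ e, Y i e ^ 2 = ∑ f, (Y.transpose * Y) f f := by
    rw [Finset.sum_comm]
    simp [Matrix.mul_apply, sq]
  rw [eval_centeredSqNormPoly, sum_sq_mulVec, hdiag, dotProduct, ← Finset.sum_sub_distrib]
  refine Finset.sum_congr rfl fun f _ => ?_
  rw [Matrix.mulVec, dotProduct, Finset.mul_sum, ← Finset.add_sum_erase _ _ (Finset.mem_univ f),
    ← Finset.add_sum_erase (a := f) _ (fun e => if e = f then 0 else _) (Finset.mem_univ f)]
  rw [if_pos rfl, zero_add]
  have h1 : x f * ((Y.transpose * Y) f f * x f) = (Y.transpose * Y) f f := by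
    linear_combination (Y.transpose * Y) f f * hx2 f
  rw [h1, add_sub_cancel_left]
  refine Finset.sum_congr rfl fun e he => ?_
  rw [if_neg (Finset.ne_of_mem_erase he)]
  ring

/-- Exponential moments of `‖Y x‖² - ‖Y‖_F²` for a random sign vector `x`. -/
theorem signAvg_exp_centeredSqNorm_le (Y : Matrix κ ι ℝ) {K t : ℝ} (hK0 : 0 ≤ K)
    (hK : ∀ x : ι → ℝ, ∑ i, (Y.mulVec x) i ^ 2 ≤ K * ∑ e, x e ^ 2)
    (ht : 32 * t ^ 2 * K ^ 2 ≤ 1) :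
    signAvg (fun x => Real.exp (t * MvPolynomial.eval x (centeredSqNormPoly Y))) ≤
      Real.exp (16 * t ^ 2 * (K * ∑ i, ∑ e, Y i e ^ 2)) := by
  classical
  have hT := sum_sq_transpose_mulVec_le hK0 hK
  have hB : ∀ x : ι → ℝ,
      ∑ f, ((Y.transpose * Y).mulVec x) f ^ 2 ≤ K ^ 2 * ∑ e, x e ^ 2 := by
    intro x
    rw [← Matrix.mulVec_mulVec]
    refine (hT _).trans ?_
    rw [sq, mul_assoc]
    exact mul_le_mul_of_nonneg_left (hK x) hK0
  rw [signAvg_congr fun x hx => by rw [eval_centeredSqNormPoly_eq_offDiag Y hx]]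
  refine (signAvg_exp_offDiag_le (Y.transpose * Y) hB (by positivity) ht).trans ?_
  refine Real.exp_le_exp.2 (mul_le_mul_of_nonneg_left ?_ (by positivity))
  -- The columns of `YᵀY` are `Yᵀ` applied to the columns of `Y`, so `‖YᵀY‖_F² ≤ K ‖Y‖_F²`.
  rw [Finset.sum_comm, Finset.sum_comm (f := fun i e => Y i e ^ 2), Finset.mul_sum]
  exact Finset.sum_le_sum fun e _ => hT fun i => Y i e

/-- Deviation of `‖Y x‖²` for `l`-wise independent random signs `x`. -/
theorem measureReal_le_abs_sq_norm_sub_le {Ω : Type*} [MeasurableSpace Ω] {P : Measure Ω}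
    [IsProbabilityMeasure P] {l q : ℕ} {x : ι → Ω → ℝ}
    (hx : ∀ i, IsRandomSign P (x i)) (hind : IsWiseIndep P l x) (Y : Matrix κ ι ℝ)
    (hq : Even q) (hql : 2 * q ≤ l) {t τ K : ℝ} (hK0 : 0 ≤ K)
    (hK : ∀ x : ι → ℝ, ∑ i, (Y.mulVec x) i ^ 2 ≤ K * ∑ e, x e ^ 2)
    (ht0 : 0 < t) (ht : 32 * t ^ 2 * K ^ 2 ≤ 1) (hτ : 0 < τ) :
    P.real {ω | τ ≤ |∑ i, (Y.mulVec fun e => x e ω) i ^ 2 - ∑ i, ∑ e, Y i e ^ 2|} ≤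
      (q / (t * τ)) ^ q * (2 * Real.exp (16 * t ^ 2 * (K * ∑ i, ∑ e, Y i e ^ 2))) := by
  simp_rw [← eval_centeredSqNormPoly]
  refine measureReal_le_abs_eval_le hx hind _ (totalDegree_centeredSqNormPoly_le Y) hq hql ht0 hτ
    (signAvg_exp_centeredSqNorm_le Y hK0 hK ht) ?_
  have := signAvg_exp_centeredSqNorm_le Y (t := -t) hK0 hK (by rwa [neg_sq])
  rwa [neg_sq] at this

theorem sum_sq_mulVec_le_matSpectralNorm {n p : ℕ} (X : Matrix (Fin n) (Fin p) ℝ)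
    (x : Fin p → ℝ) :
    ∑ i, (X.mulVec x) i ^ 2 ≤ matSpectralNorm X ^ 2 * ∑ j, x j ^ 2 := by
  have h := pow_le_pow_left₀ (norm_nonneg _) (X.l2_opNorm_mulVec (WithLp.toLp 2 x)) 2
  rw [mul_pow, EuclideanSpace.norm_sq_eq, EuclideanSpace.norm_sq_eq] at h
  simpa [matSpectralNorm] using h

theorem matFrobeniusNorm_sq {n p : ℕ} (X : Matrix (Fin n) (Fin p) ℝ) :
    matFrobeniusNorm X ^ 2 = ∑ i, ∑ j, X i j ^ 2 :=
  Real.sq_sqrt (by positivity)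

/-- The matrix of `R ↦ X R v` as a linear map in the entries of `R`. -/
def productCoeff {n p d : ℕ} (X : Matrix (Fin n) (Fin p) ℝ) (v : Fin d → ℝ) :
    Matrix (Fin n) (Fin p × Fin d) ℝ :=
  Matrix.of fun i e => X i e.1 * v e.2

theorem productCoeff_mulVec {n p d : ℕ} (X : Matrix (Fin n) (Fin p) ℝ) (v : Fin d → ℝ)
    (x : Fin p × Fin d → ℝ) :
    (productCoeff X v).mulVec x = X.mulVec fun j => ∑ a, v a * x (j, a) := by
  funext i
  simp only [productCoeff, Matrix.mulVec, dotProduct, Matrix.of_apply, Fintype.sum_prod_type,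
    Finset.mul_sum, mul_assoc]

theorem sum_sq_productCoeff {n p d : ℕ} (X : Matrix (Fin n) (Fin p) ℝ) {v : Fin d → ℝ}
    (hv : ∑ a, v a ^ 2 = 1) :
    ∑ i, ∑ e, productCoeff X v i e ^ 2 = matFrobeniusNorm X ^ 2 := by
  rw [matFrobeniusNorm_sq]
  refine Finset.sum_congr rfl fun i _ => ?_
  simp only [productCoeff, Matrix.of_apply, Fintype.sum_prod_type, mul_pow, ← Finset.mul_sum, hv,
    mul_one]

/-- Contracting each row of `R` with the unit vector `v` does not increase its norm, by
Cauchy–Schwarz. -/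
theorem sum_sq_productCoeff_mulVec_le {n p d : ℕ} (X : Matrix (Fin n) (Fin p) ℝ) {v : Fin d → ℝ}
    (hv : ∑ a, v a ^ 2 = 1) (x : Fin p × Fin d → ℝ) :
    ∑ i, ((productCoeff X v).mulVec x) i ^ 2 ≤ matSpectralNorm X ^ 2 * ∑ e, x e ^ 2 := by
  rw [productCoeff_mulVec]
  refine (sum_sq_mulVec_le_matSpectralNorm X _).trans
    (mul_le_mul_of_nonneg_left ?_ (by positivity))
  rw [Fintype.sum_prod_type]
  refine Finset.sum_le_sum fun j _ => (Finset.sum_mul_sq_le_sq_mul_sq _ _ _).trans_eq ?_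
  rw [hv, one_mul]

/-- Deviation of `‖X R v‖²` for a fixed unit vector `v`. -/
theorem measureReal_fixed_vector_le {Ω : Type*} [MeasurableSpace Ω] {P : Measure Ω}
    [IsProbabilityMeasure P] {n p d : ℕ} {ε : ℝ} {X : Matrix (Fin n) (Fin p) ℝ}
    {R : Ω → Matrix (Fin p) (Fin d) ℝ} (hε : 0 < ε) (hε1 : ε < 1)
    (hR : ∀ i j, IsRandomSign P (fun ω => R ω i j))
    (hind : IsWiseIndep P ⌊2 * stableRank X⌋₊ (fun (e : Fin p × Fin d) (ω : Ω) => R ω e.1 e.2))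
    (hs : 38400 ≤ ε ^ 2 * stableRank X) {v : Fin d → ℝ} (hv : ∑ a, v a ^ 2 = 1) :
    P.real {ω | ε / 4 * matFrobeniusNorm X ^ 2 ≤
        |∑ i, ((X * R ω).mulVec v) i ^ 2 - matFrobeniusNorm X ^ 2|} ≤
      2 * Real.exp (-(ε ^ 2 * stableRank X / 50000)) := by
  set s := stableRank X with hsdef
  set σ := matSpectralNorm X with hσdef
  have hs0 : 0 < s := by
    by_contra h
    nlinarith [sq_nonneg ε]
  -- Division by zero gives zero, so a positive stable rank already excludes `X = 0`.
  have hσ : σ ≠ 0 := by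
    intro h
    rw [hsdef, stableRank, ← hσdef, h] at hs0
    simp at hs0
  have hF : matFrobeniusNorm X ^ 2 = s * σ ^ 2 := by
    rw [hsdef, stableRank, ← hσdef]
    field_simp
  -- The moment order is `q = 2N`. With `t = ε / (800 σ²)` and `τ = ε ‖X‖_F² / 4` one has `t τ = ε²
  -- s / 3200`, so `q / (t τ) ≤ 1/3 ≤ e⁻¹`.
  set N := ⌊ε ^ 2 * s / 19200⌋₊ with hN
  have hN1 : (N : ℝ) ≤ ε ^ 2 * s / 19200 := Nat.floor_le (by positivity)
  have hN2 : ε ^ 2 * s / 19200 < N + 1 := Nat.lt_floor_add_one _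
  have hε2 : ε ^ 2 ≤ 1 := by nlinarith
  have hql : 2 * (2 * N) ≤ ⌊2 * s⌋₊ := by
    refine Nat.le_floor ?_
    push_cast
    nlinarith
  have hσ2 : 0 < σ ^ 2 := by positivity
  have h := measureReal_le_abs_sq_norm_sub_le (x := fun (e : Fin p × Fin d) ω => R ω e.1 e.2)
    (fun e => hR e.1 e.2) hind (productCoeff X v) (even_two_mul N) hql hσ2.le
    (sum_sq_productCoeff_mulVec_le X hv) (t := ε / 800 / σ ^ 2) (by positivity)
    (by
      have : 32 * (ε / 800 / σ ^ 2) ^ 2 * (σ ^ 2) ^ 2 = ε ^ 2 / 20000 := by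
        field_simp
        norm_num
      rw [this]
      linarith)
    (τ := ε / 4 * matFrobeniusNorm X ^ 2) (by rw [hF]; positivity)
  rw [sum_sq_productCoeff X hv, hF] at h
  have hvec : ∀ ω, (productCoeff X v).mulVec (fun e : Fin p × Fin d => R ω e.1 e.2) =
      (X * R ω).mulVec v := by
    intro ω
    rw [productCoeff_mulVec, ← Matrix.mulVec_mulVec]
    congr 1
    funext j
    simp [Matrix.mulVec, dotProduct, mul_comm]
  simp_rw [hvec] at h
  rw [hF]
  refine h.trans ?_
  have h1 : ε / 800 / σ ^ 2 * (ε / 4 * (s * σ ^ 2)) = ε ^ 2 * s / 3200 := by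
    field_simp
    norm_num
  have h2 : 16 * (ε / 800 / σ ^ 2) ^ 2 * (σ ^ 2 * (s * σ ^ 2)) = ε ^ 2 * s / 40000 := by
    field_simp
    norm_num
  rw [h1, h2]
  have h3 : ((2 * N : ℕ) : ℝ) / (ε ^ 2 * s / 3200) ≤ Real.exp (-1) := by
    have he : (1 : ℝ) / 3 ≤ Real.exp (-1) := by
      rw [Real.exp_neg, one_div]
      exact inv_anti₀ (Real.exp_pos 1) (by linarith [Real.exp_one_lt_d9])
    refine le_trans ?_ he
    rw [div_le_iff₀ (by positivity)]
    push_cast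
    linarith
  calc _ ≤ Real.exp (-1) ^ (2 * N) * (2 * Real.exp (ε ^ 2 * s / 40000)) := by gcongr
    _ = 2 * Real.exp (-(2 * N) + ε ^ 2 * s / 40000) := by
      rw [← Real.exp_nat_mul, Real.exp_add]
      push_cast
      ring_nf
    -- The floor costs at most `2` in the exponent; `ε² s ≥ 38400` absorbs it, since `38400 (1/9600
    -- - 1/40000 - 1/50000) > 2`.
    _ ≤ _ := by
      gcongr
      linarith

end HansonWright

/-! ### Nets of coordinate spheres and the passage from a net to the sphere. -/

section Net

/-- Number of lattice points (in signed coordinates) supported in `T` in a Euclidean ball. -/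
theorem card_signed_lattice_le {d : ℕ} (T : Finset (Fin d)) (L : ℕ) (r : ℝ) :
    (((Fintype.piFinset fun i : Fin d => if i ∈ T then (Finset.univ : Finset ℤˣ) ×ˢ
      Finset.range L else {(1, 0)}).filter fun z => ∑ i, ((z i).2 : ℝ) ^ 2 ≤ r).card : ℝ) ≤
      Real.exp r * 4 ^ T.card := by
  set S : Fin d → Finset (ℤˣ × ℕ) := fun i => if i ∈ T then (Finset.univ : Finset ℤˣ) ×ˢ
      Finset.range L else {(1, 0)} with hS
  -- Lattice points in the ball are counted with the weight `exp (r - ∑ z_i²) ≥ 1`, which factorizes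
  -- over the coordinates. A coordinate in `T` contributes at most `2 ∑ 2^(-m) ≤ 4`; counting zero
  -- with both signs is harmless.
  have hone : ∀ i, ∑ y ∈ S i, Real.exp (-(y.2 : ℝ) ^ 2) ≤ if i ∈ T then 4 else 1 := by
    intro i
    by_cases hi : i ∈ T
    · simp only [hS, hi, if_true]
      rw [Finset.sum_product]
      simp only [Finset.sum_const, Finset.card_univ, Fintype.card_units_int, nsmul_eq_mul]
      have h1 : ∑ m ∈ Finset.range L, Real.exp (-(m : ℝ) ^ 2) ≤
          ∑ m ∈ Finset.range L, (1 / 2 : ℝ) ^ m := by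
        refine Finset.sum_le_sum fun m _ => ?_
        have h2 : Real.exp (-(m : ℝ) ^ 2) ≤ Real.exp (m * (-1)) := by
          refine Real.exp_le_exp.2 ?_
          have : (m : ℝ) ≤ (m : ℝ) ^ 2 := by exact_mod_cast Nat.le_self_pow two_ne_zero m
          linarith
        refine h2.trans ?_
        rw [Real.exp_nat_mul]
        refine pow_le_pow_left₀ (Real.exp_pos _).le ?_ m
        rw [Real.exp_neg, one_div]
        exact inv_anti₀ two_pos (by linarith [Real.exp_one_gt_d9])
      have := h1.trans (sum_geometric_two_le L)
      push_cast
      linarith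
    · simp [hS, hi]
  calc _ = ∑ z ∈ (Fintype.piFinset S).filter fun z => ∑ i, ((z i).2 : ℝ) ^ 2 ≤ r, (1 : ℝ) := by
        simp
    _ ≤ ∑ z ∈ (Fintype.piFinset S).filter fun z => ∑ i, ((z i).2 : ℝ) ^ 2 ≤ r,
          Real.exp r * ∏ i, Real.exp (-((z i).2 : ℝ) ^ 2) := by
        refine Finset.sum_le_sum fun z hz => ?_
        rw [← Real.exp_sum, ← Real.exp_add, Finset.sum_neg_distrib]
        exact Real.one_le_exp (by linarith [(Finset.mem_filter.1 hz).2])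
    _ ≤ ∑ z ∈ Fintype.piFinset S, Real.exp r * ∏ i, Real.exp (-((z i).2 : ℝ) ^ 2) :=
        Finset.sum_le_sum_of_subset_of_nonneg (Finset.filter_subset _ _)
          fun z _ _ => by positivity
    _ = Real.exp r * ∏ i, ∑ y ∈ S i, Real.exp (-(y.2 : ℝ) ^ 2) := by
        rw [← Finset.mul_sum, Finset.prod_univ_sum]
    _ ≤ Real.exp r * ∏ i, (if i ∈ T then 4 else 1 : ℝ) := by
        refine mul_le_mul_of_nonneg_left (Finset.prod_le_prod (fun i _ => ?_) fun i _ => hone i)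
          (Real.exp_pos _).le
        exact Finset.sum_nonneg fun y _ => (Real.exp_pos _).le
    _ = _ := by rw [Finset.prod_ite_mem, Finset.univ_inter, Finset.prod_const]

/-- A net of unit vectors, up to shrinking, for the unit sphere of a coordinate subspace. -/
theorem exists_net_coordinate_sphere {d k : ℕ} (hk : 1 ≤ k) (T : Finset (Fin d))
    (hT : T.card = k) :
    ∃ N : Finset (Fin d → ℝ), (N.card : ℝ) ≤ Real.exp (18 * k) ∧
      (∀ v ∈ N, ∑ i, v i ^ 2 = 1 ∧ ∀ i ∉ T, v i = 0) ∧
      ∀ u : Fin d → ℝ, ∑ i, u i ^ 2 = 1 → (∀ i ∉ T, u i = 0) →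
        ∃ v ∈ N, ∃ c : ℝ, 0 ≤ c ∧ c ≤ 1 ∧ ∑ i, (u i - c * v i) ^ 2 ≤ 1 / 16 := by
  classical
  have hk0 : (0 : ℝ) < k := by exact_mod_cast hk
  -- At mesh `1/a` each of the `k` coordinates has squared rounding error at most `1 / (16 k)`,
  -- hence `1/16` in all.
  set a : ℝ := 4 * √k with ha
  have ha0 : 0 < a := by positivity
  have ha2 : a ^ 2 = 16 * k := by rw [ha, mul_pow, Real.sq_sqrt hk0.le]; norm_num
  set L : ℕ := ⌊a⌋₊ + 1 with hL
  set S : Fin d → Finset (ℤˣ × ℕ) := fun i => if i ∈ T then (Finset.univ : Finset ℤˣ) ×ˢ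
      Finset.range L else {(1, 0)} with hS
  set Z := (Fintype.piFinset S).filter fun z => ∑ i, ((z i).2 : ℝ) ^ 2 ≤ 16 * k with hZ
  set w : (Fin d → ℤˣ × ℕ) → Fin d → ℝ := fun z i => ((z i).1 : ℤ) * ((z i).2 : ℝ) with hw
  set nv : (Fin d → ℝ) → Fin d → ℝ := fun x i => x i / √(∑ j, x j ^ 2) with hnv
  have hnv1 : ∀ x : Fin d → ℝ, ∑ j, x j ^ 2 ≠ 0 → ∑ i, nv x i ^ 2 = 1 := by
    intro x hx
    simp only [hnv, div_pow]
    rw [← Finset.sum_div, Real.sq_sqrt (by positivity), div_self hx]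
  refine ⟨(Z.filter fun z => ∑ i, w z i ^ 2 ≠ 0).image fun z => nv (w z), ?_, ?_, ?_⟩
  · calc _ ≤ (Z.card : ℝ) := by
          exact_mod_cast Finset.card_image_le.trans (Finset.card_filter_le _ _)
      _ ≤ Real.exp (16 * k) * 4 ^ T.card := card_signed_lattice_le T L _
      _ ≤ Real.exp (16 * k) * Real.exp 2 ^ k := by
          rw [hT]
          have : (4 : ℝ) ≤ Real.exp 2 := by
            have h1 := Real.exp_one_gt_d9
            have h2 : Real.exp 2 = Real.exp 1 * Real.exp 1 := by rw [← Real.exp_add]; norm_num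
            rw [h2]
            nlinarith
          gcongr
      _ = _ := by
          rw [← Real.exp_nat_mul, ← Real.exp_add]
          ring_nf
  · intro v hv
    obtain ⟨z, hz, rfl⟩ := Finset.mem_image.1 hv
    obtain ⟨hz1, hz2⟩ := Finset.mem_filter.1 hz
    refine ⟨hnv1 _ hz2, fun i hi => ?_⟩
    have h1 := Fintype.mem_piFinset.1 (Finset.mem_filter.1 hz1).1 i
    simp only [hS, hi, if_false, Finset.mem_singleton] at h1
    simp [hnv, hw, h1]
  · intro u hu huT
    -- Rounding toward zero keeps the lattice point in the ball of radius `a`; this yields both the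
    -- count and a shrinking factor `c ≤ 1`.
    have hex : ∀ i, ∃ y : ℤˣ × ℕ, y ∈ S i ∧ (y.2 : ℝ) ≤ a * |u i| ∧
        (u i - ((y.1 : ℤ) * (y.2 : ℝ)) / a) ^ 2 ≤
          if i ∈ T then 1 / (16 * (k : ℝ)) else 0 := by
      intro i
      by_cases hi : i ∈ T
      · have h1 : u i ^ 2 ≤ 1 := by
          rw [← hu]
          exact Finset.single_le_sum (f := fun j => u j ^ 2) (fun j _ => sq_nonneg _)
            (Finset.mem_univ i)
        have h2 : |u i| ≤ 1 := abs_le_one_iff_mul_self_le_one.2 (by rwa [← sq])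
        have h3 := Nat.floor_le (a := a * |u i|) (by positivity)
        have h4 := (Nat.lt_floor_add_one (a * |u i|)).le
        have h5 : ⌊a * |u i|⌋₊ ∈ Finset.range L := by
          rw [Finset.mem_range, hL, Nat.lt_succ_iff]
          exact Nat.floor_le_floor (mul_le_of_le_one_right ha0.le h2)
        have h6 : (|u i| - (⌊a * |u i|⌋₊ : ℝ) / a) ^ 2 ≤ 1 / (16 * k) := by
          have : |u i| - (⌊a * |u i|⌋₊ : ℝ) / a = (a * |u i| - ⌊a * |u i|⌋₊) / a := by
            field_simp
          rw [this, div_pow, ha2]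
          gcongr
          exact pow_le_one₀ (by linarith) (by linarith)
        rcases abs_cases (u i) with ⟨h, _⟩ | ⟨h, _⟩
        · refine ⟨(1, ⌊a * |u i|⌋₊), by simpa [hS, hi] using h5, h3, ?_⟩
          rw [if_pos hi]
          refine le_of_eq_of_le ?_ h6
          rw [h]
          simp
        · refine ⟨(-1, ⌊a * |u i|⌋₊), by simpa [hS, hi] using h5, h3, ?_⟩
          rw [if_pos hi]
          refine le_of_eq_of_le ?_ h6
          rw [h]
          push_cast
          ring
      · exact ⟨(1, 0), by simp [hS, hi], by simp; positivity, by simp [hi, huT i hi]⟩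
    choose z hzS hzu hzerr using hex
    have hzsq : ∑ i, ((z i).2 : ℝ) ^ 2 ≤ 16 * k := by
      calc ∑ i, ((z i).2 : ℝ) ^ 2 ≤ ∑ i, 16 * k * u i ^ 2 := by
            refine Finset.sum_le_sum fun i _ => ?_
            rw [← ha2, ← sq_abs (u i), ← mul_pow]
            exact pow_le_pow_left₀ (by positivity) (hzu i) 2
        _ = 16 * k := by rw [← Finset.mul_sum, hu, mul_one]
    have hwsq : ∑ i, w z i ^ 2 ≤ a ^ 2 := by
      rw [ha2]
      refine le_of_eq_of_le (Finset.sum_congr rfl fun i _ => ?_) hzsq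
      simp only [hw, mul_pow]
      rcases Int.units_eq_one_or (z i).1 with h | h <;> simp [h]
    have herr : ∑ i, (u i - w z i / a) ^ 2 ≤ 1 / 16 := by
      refine (Finset.sum_le_sum fun i _ => hzerr i).trans_eq ?_
      rw [Finset.sum_ite_mem, Finset.univ_inter, Finset.sum_const, hT, nsmul_eq_mul]
      field_simp
    have hne : ∑ i, w z i ^ 2 ≠ 0 := by
      intro h0
      have h1 : ∀ i, w z i = 0 := fun i => by
        have := (Finset.sum_eq_zero_iff_of_nonneg fun i _ => sq_nonneg (w z i)).1 h0 i
          (Finset.mem_univ i)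
        exact pow_eq_zero_iff two_ne_zero |>.1 this
      simp only [h1, zero_div, sub_zero, hu] at herr
      norm_num at herr
    set ρ := √(∑ j, w z j ^ 2) with hρ
    have hρ0 : ρ ≠ 0 := (Real.sqrt_ne_zero (by positivity)).2 hne
    refine ⟨nv (w z), Finset.mem_image.2 ⟨z, Finset.mem_filter.2 ⟨Finset.mem_filter.2
      ⟨Fintype.mem_piFinset.2 hzS, hzsq⟩, hne⟩, rfl⟩, ρ / a, by positivity, ?_, ?_⟩
    · rw [div_le_one ha0]
      exact Real.sqrt_le_iff.2 ⟨ha0.le, hwsq⟩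
    · refine le_of_eq_of_le (Finset.sum_congr rfl fun i _ => ?_) herr
      have : ρ / a * nv (w z) i = w z i / a := by
        simp only [hnv, ← hρ]
        field_simp
      rw [this]

/-- The quadratic form `‖A x‖² - F ‖x‖²`. -/
def shiftedSqNorm {n d : ℕ} (A : Matrix (Fin n) (Fin d) ℝ) (F : ℝ) (x : Fin d → ℝ) : ℝ :=
  ∑ i, (A.mulVec x) i ^ 2 - F * ∑ a, x a ^ 2

theorem shiftedSqNorm_smul {n d : ℕ} (A : Matrix (Fin n) (Fin d) ℝ) (F c : ℝ) (x : Fin d → ℝ) :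
    shiftedSqNorm A F (c • x) = c ^ 2 * shiftedSqNorm A F x := by
  simp only [shiftedSqNorm, Matrix.mulVec_smul, Pi.smul_apply, smul_eq_mul, mul_pow,
    ← Finset.mul_sum]
  ring

/-- Polarization with a free scale `t`, which balances a short `u - w` against a long `u + w`. -/
theorem shiftedSqNorm_sub {n d : ℕ} (A : Matrix (Fin n) (Fin d) ℝ) (F : ℝ) {t : ℝ} (ht : t ≠ 0)
    (u w : Fin d → ℝ) :
    4 * (shiftedSqNorm A F u - shiftedSqNorm A F w) =
      shiftedSqNorm A F (t • (u - w) + t⁻¹ • (u + w)) -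
        shiftedSqNorm A F (t • (u - w) - t⁻¹ • (u + w)) := by
  have key : ∀ x y : ℝ, 4 * (x ^ 2 - y ^ 2) = (t * (x - y) + t⁻¹ * (x + y)) ^ 2 -
      (t * (x - y) - t⁻¹ * (x + y)) ^ 2 := by
    intro x y
    field_simp
    ring
  have h1 : 4 * (∑ i, (A.mulVec u) i ^ 2 - ∑ i, (A.mulVec w) i ^ 2) =
      ∑ i, (A.mulVec (t • (u - w) + t⁻¹ • (u + w))) i ^ 2 -
        ∑ i, (A.mulVec (t • (u - w) - t⁻¹ • (u + w))) i ^ 2 := by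
    rw [← Finset.sum_sub_distrib, ← Finset.sum_sub_distrib, Finset.mul_sum]
    refine Finset.sum_congr rfl fun i _ => ?_
    simp only [Matrix.mulVec_add, Matrix.mulVec_sub, Matrix.mulVec_smul, Pi.add_apply, Pi.sub_apply,
      Pi.smul_apply, smul_eq_mul]
    exact key _ _
  have h2 : 4 * (∑ a, u a ^ 2 - ∑ a, w a ^ 2) =
      ∑ a, (t • (u - w) + t⁻¹ • (u + w)) a ^ 2 - ∑ a, (t • (u - w) - t⁻¹ • (u + w)) a ^ 2 := by
    rw [← Finset.sum_sub_distrib, ← Finset.sum_sub_distrib, Finset.mul_sum]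
    refine Finset.sum_congr rfl fun i _ => ?_
    simp only [Pi.add_apply, Pi.sub_apply, Pi.smul_apply, smul_eq_mul]
    exact key _ _
  simp only [shiftedSqNorm]
  linear_combination h1 - F * h2

theorem continuous_shiftedSqNorm {n d : ℕ} (A : Matrix (Fin n) (Fin d) ℝ) (F : ℝ) :
    Continuous (shiftedSqNorm A F) := by
  unfold shiftedSqNorm
  simp only [Matrix.mulVec, dotProduct]
  fun_prop

/-- Passing from a net to the whole unit sphere of a coordinate subspace. -/
theorem abs_shiftedSqNorm_le_of_net {n d : ℕ} (A : Matrix (Fin n) (Fin d) ℝ) {F m : ℝ}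
    {T : Finset (Fin d)} {N : Finset (Fin d → ℝ)}
    (hNT : ∀ v ∈ N, ∑ i, v i ^ 2 = 1 ∧ ∀ i ∉ T, v i = 0)
    (hN : ∀ u : Fin d → ℝ, ∑ i, u i ^ 2 = 1 → (∀ i ∉ T, u i = 0) →
        ∃ v ∈ N, ∃ c : ℝ, 0 ≤ c ∧ c ≤ 1 ∧ ∑ i, (u i - c * v i) ^ 2 ≤ 1 / 16)
    (hm : ∀ v ∈ N, |shiftedSqNorm A F v| ≤ m) {u : Fin d → ℝ} (hu : ∑ i, u i ^ 2 = 1)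
    (huT : ∀ i ∉ T, u i = 0) : |shiftedSqNorm A F u| ≤ 4 * m := by
  set S : Set (Fin d → ℝ) := {x | ∑ i, x i ^ 2 = 1 ∧ ∀ i ∉ T, x i = 0} with hS
  have hclosed : IsClosed S := by
    have h1 : IsClosed {x : Fin d → ℝ | ∑ i, x i ^ 2 = 1} :=
      isClosed_eq (by fun_prop) continuous_const
    have h2 : IsClosed {x : Fin d → ℝ | ∀ i ∉ T, x i = 0} := by
      simp only [Set.ofPred_forall]
      exact isClosed_iInter fun i => isClosed_iInter fun _ =>
        isClosed_eq (continuous_apply i) continuous_const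
    exact h1.inter h2
  have hbdd : Bornology.IsBounded S := by
    refine (Metric.isBounded_closedBall (x := (0 : Fin d → ℝ)) (r := 1)).subset fun x hx => ?_
    rw [mem_closedBall_zero_iff, pi_norm_le_iff_of_nonneg zero_le_one]
    intro i
    have h1 : x i ^ 2 ≤ 1 := by
      rw [← hx.1]
      exact Finset.single_le_sum (f := fun j => x j ^ 2) (fun j _ => sq_nonneg _)
        (Finset.mem_univ i)
    exact abs_le_one_iff_mul_self_le_one.2 (by rwa [← sq])
  -- At a maximizer the form is compared with its value at a net point, and the difference is
  -- bounded by a multiple of the maximum `β` itself.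
  obtain ⟨u₀, hu₀, hmax⟩ := (Metric.isCompact_of_isClosed_isBounded hclosed hbdd).exists_isMaxOn
    ⟨u, hu, huT⟩ (continuous_shiftedSqNorm A F).abs.continuousOn
  set β := |shiftedSqNorm A F u₀| with hβ
  have hβ0 : 0 ≤ β := abs_nonneg _
  have hgen : ∀ x : Fin d → ℝ, (∀ i ∉ T, x i = 0) → |shiftedSqNorm A F x| ≤ β * ∑ i, x i ^ 2 := by
    intro x hxT
    by_cases hx : ∑ i, x i ^ 2 = 0
    · have h1 : x = 0 := by
        funext i
        have := (Finset.sum_eq_zero_iff_of_nonneg fun i _ => sq_nonneg (x i)).1 hx i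
          (Finset.mem_univ i)
        exact pow_eq_zero_iff two_ne_zero |>.1 this
      subst h1
      simp [shiftedSqNorm]
    · set ρ := √(∑ i, x i ^ 2) with hρ
      have hρ0 : ρ ≠ 0 := (Real.sqrt_ne_zero (by positivity)).2 hx
      have hρ2 : ρ ^ 2 = ∑ i, x i ^ 2 := Real.sq_sqrt (by positivity)
      have hmem : ρ⁻¹ • x ∈ S := by
        refine ⟨?_, fun i hi => by simp [hxT i hi]⟩
        simp only [Pi.smul_apply, smul_eq_mul, mul_pow, ← Finset.mul_sum, ← hρ2]
        field_simp
      have h1 : |shiftedSqNorm A F (ρ⁻¹ • x)| ≤ β := hmax hmem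
      have h2 : x = ρ • (ρ⁻¹ • x) := by rw [smul_smul, mul_inv_cancel₀ hρ0, one_smul]
      rw [h2, shiftedSqNorm_smul, abs_mul, abs_of_nonneg (sq_nonneg ρ), ← h2, ← hρ2, mul_comm]
      exact mul_le_mul_of_nonneg_right h1 (sq_nonneg ρ)
  obtain ⟨v, hvN, c, hc0, hc1, hcv⟩ := hN u₀ hu₀.1 hu₀.2
  set w : Fin d → ℝ := c • v with hw
  have hvT := (hNT v hvN).2
  have hwm : |shiftedSqNorm A F w| ≤ m := by
    rw [hw, shiftedSqNorm_smul, abs_mul, abs_of_nonneg (sq_nonneg c)]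
    have h1 := hm v hvN
    exact (mul_le_of_le_one_left (abs_nonneg _) (pow_le_one₀ hc0 hc1)).trans h1
  have hw1 : ∑ i, w i ^ 2 ≤ 1 := by
    simp only [hw, Pi.smul_apply, smul_eq_mul, mul_pow, ← Finset.mul_sum, (hNT v hvN).1]
    nlinarith
  have hz : ∑ i, (u₀ i - w i) ^ 2 ≤ 1 / 16 := by simpa [hw] using hcv
  have hy : ∑ i, (u₀ i + w i) ^ 2 ≤ 4 := by
    calc ∑ i, (u₀ i + w i) ^ 2 ≤ ∑ i, (2 * u₀ i ^ 2 + 2 * w i ^ 2) :=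
          Finset.sum_le_sum fun i _ => by nlinarith [sq_nonneg (u₀ i - w i)]
      _ = 2 * ∑ i, u₀ i ^ 2 + 2 * ∑ i, w i ^ 2 := by
          rw [Finset.sum_add_distrib, Finset.mul_sum, Finset.mul_sum]
      _ ≤ 4 := by linarith [hu₀.1]
  have hpar : ∑ i, ((3 : ℝ) • (u₀ - w) + (3 : ℝ)⁻¹ • (u₀ + w)) i ^ 2 +
      ∑ i, ((3 : ℝ) • (u₀ - w) - (3 : ℝ)⁻¹ • (u₀ + w)) i ^ 2 =
      18 * ∑ i, (u₀ i - w i) ^ 2 + 2 / 9 * ∑ i, (u₀ i + w i) ^ 2 := by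
    rw [← Finset.sum_add_distrib, Finset.mul_sum, Finset.mul_sum, ← Finset.sum_add_distrib]
    refine Finset.sum_congr rfl fun i _ => ?_
    simp only [Pi.add_apply, Pi.sub_apply, Pi.smul_apply, smul_eq_mul]
    ring
  -- The scale should minimize `2 t² / 16 + 2 · 4 / t²`, whose optimum is `t = √8`. The value `t =
  -- 3` gives `145/72`, hence `β ≤ (145/288) β + m` and `β ≤ 4 m`.
  have hsub := shiftedSqNorm_sub A F (t := 3) (by norm_num) u₀ w
  have hwT : ∀ i ∉ T, w i = 0 := fun i hi => by simp [hw, hvT i hi]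
  have h1 := hgen ((3 : ℝ) • (u₀ - w) + (3 : ℝ)⁻¹ • (u₀ + w))
    fun i hi => by simp [hwT i hi, hu₀.2 i hi]
  have h2 := hgen ((3 : ℝ) • (u₀ - w) - (3 : ℝ)⁻¹ • (u₀ + w))
    fun i hi => by simp [hwT i hi, hu₀.2 i hi]
  have h3 : 4 * |shiftedSqNorm A F u₀ - shiftedSqNorm A F w| ≤
      β * (18 * (1 / 16) + 2 / 9 * 4) := by
    have habs : 4 * |shiftedSqNorm A F u₀ - shiftedSqNorm A F w| =
        |4 * (shiftedSqNorm A F u₀ - shiftedSqNorm A F w)| := by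
      rw [abs_mul, abs_of_pos (four_pos : (0 : ℝ) < 4)]
    rw [habs, hsub]
    refine (abs_sub _ _).trans ((add_le_add h1 h2).trans ?_)
    rw [← mul_add, hpar]
    gcongr
  have h4 : β ≤ |shiftedSqNorm A F u₀ - shiftedSqNorm A F w| + |shiftedSqNorm A F w| := by
    simpa using abs_add_le (shiftedSqNorm A F u₀ - shiftedSqNorm A F w) (shiftedSqNorm A F w)
  have h5 : |shiftedSqNorm A F u| ≤ β := hmax ⟨hu, huT⟩
  linarith

/-- The bound `\binom{d}{k} ≤ (e d / k)^k`. -/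
theorem choose_le_exp {d k : ℕ} (hk : 1 ≤ k) (hkd : k ≤ d) :
    (d.choose k : ℝ) ≤ Real.exp (k + k * Real.log (d / k)) := by
  have hk0 : (0 : ℝ) < k := by exact_mod_cast hk
  have hd0 : (0 : ℝ) < d := by exact_mod_cast hk.trans hkd
  have h1 : (d.choose k : ℝ) ≤ (d : ℝ) ^ k / k.factorial := Nat.choose_le_pow_div k d
  have h2 := Real.pow_div_factorial_le_exp (k : ℝ) hk0.le k
  rw [Real.exp_add, Real.exp_nat_mul, Real.exp_log (by positivity)]
  calc (d.choose k : ℝ) ≤ (d : ℝ) ^ k / k.factorial := h1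
    _ = (k : ℝ) ^ k / k.factorial * (d / k) ^ k := by
      rw [div_pow]
      field_simp
    _ ≤ _ := by gcongr

end Net

/-! ### From squared norms to RIP, and the union bound. -/

/-- Square roots cost nothing, as `(1 - ε)² ≤ 1 - ε` and `1 + ε ≤ (1 + ε)²`. Since `k ≤ d`, a sparse
support extends to a set of exactly `k` coordinates. -/
theorem productRIP_of_abs_shiftedSqNorm_le {n p d k : ℕ} {ε : ℝ} (hε : 0 < ε) (hε1 : ε < 1)
    {X : Matrix (Fin n) (Fin p) ℝ} {R : Matrix (Fin p) (Fin d) ℝ} (hkd : k ≤ d)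
    (h : ∀ T : Finset (Fin d), T.card = k → ∀ u : Fin d → ℝ, ∑ i, u i ^ 2 = 1 →
      (∀ i ∉ T, u i = 0) →
        |shiftedSqNorm (X * R) (matFrobeniusNorm X ^ 2) u| ≤ ε * matFrobeniusNorm X ^ 2) :
    ProductRIP X R k ε := by
  intro u hu
  have hF : 0 ≤ matFrobeniusNorm X := Real.sqrt_nonneg _
  have hu1 : ∑ i, u i ^ 2 = 1 := by
    have := EuclideanSpace.norm_sq_eq u
    rw [hu.1] at this
    simpa using this.symm
  obtain ⟨T, hT, hTk⟩ := Finset.exists_superset_card_eq (s := Finset.univ.filter fun i => u i ≠ 0)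
    hu.2 (by simpa using hkd)
  have hb := h T hTk (WithLp.ofLp u) hu1 fun i hi => by
    by_contra hne
    exact hi (hT (by simpa using hne))
  rw [shiftedSqNorm, hu1, mul_one, abs_le] at hb
  set y := ‖WithLp.toLp 2 ((X * R).mulVec (WithLp.ofLp u))‖ with hy
  have hy2 : y ^ 2 = ∑ i, ((X * R).mulVec (WithLp.ofLp u)) i ^ 2 := by
    rw [hy, EuclideanSpace.norm_sq_eq]
    simp
  rw [← hy2] at hb
  have hy0 : 0 ≤ y := norm_nonneg _
  have hF2 := sq_nonneg (matFrobeniusNorm X)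
  constructor
  · refine le_of_sq_le_sq ?_ hy0
    rw [mul_pow]
    nlinarith [mul_nonneg (mul_nonneg hε.le (sub_nonneg.2 hε1.le)) hF2]
  · refine le_of_sq_le_sq ?_ (by positivity)
    rw [mul_pow]
    nlinarith [mul_nonneg (mul_nonneg hε.le hε.le) hF2, mul_nonneg hε.le hF2]

theorem mainTheorem2 :
    ∃ C c : ℝ, 0 < C ∧ 0 < c ∧
      ∀ (Ω : Type*) [MeasurableSpace Ω] (P : MeasureTheory.Measure Ω)
        [MeasureTheory.IsProbabilityMeasure P]
        (n p d k : ℕ) (ε : ℝ) (X : Matrix (Fin n) (Fin p) ℝ)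
        (R : Ω → Matrix (Fin p) (Fin d) ℝ),
        0 < ε → ε < 1 → 1 ≤ k → k ≤ d →
        (∀ i j, IsRandomSign P (fun ω => R ω i j)) →
        IsWiseIndep P ⌊2 * stableRank X⌋₊ (fun (e : Fin p × Fin d) (ω : Ω) => R ω e.1 e.2) →
        C * ((k : ℝ) / ε ^ 2) * max 1 (Real.log ((d : ℝ) / (k : ℝ))) ≤ stableRank X →
        1 - Real.exp (-(c * ε ^ 2 * stableRank X)) ≤ P.real {ω | ProductRIP X (R ω) k ε} := by
  -- With `ℓ = max 1 (log (d/k))`, the union bound adds at most `19 k + k ℓ + 1 ≤ 21 k ℓ ≤ 21 · 10⁻⁷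
  -- ε² s` to the exponent `-ε² s / 50000`, leaving more than `ε² s / 10⁵` of decay.
  refine ⟨10 ^ 7, 1 / 10 ^ 5, by norm_num, by norm_num, ?_⟩
  intro Ω _ P _ n p d k ε X R hε hε1 hk hkd hR hind hsr
  set s := stableRank X with hs
  set ℓ := max 1 (Real.log ((d : ℝ) / (k : ℝ))) with hℓ
  set F2 := matFrobeniusNorm X ^ 2 with hF2
  have hℓ1 : 1 ≤ ℓ := le_max_left _ _
  have hk1 : (1 : ℝ) ≤ k := by exact_mod_cast hk
  have hkℓ : 10 ^ 7 * (k * ℓ) ≤ ε ^ 2 * s := by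
    calc 10 ^ 7 * (k * ℓ) = ε ^ 2 * (10 ^ 7 * ((k : ℝ) / ε ^ 2) * ℓ) := by field_simp
      _ ≤ ε ^ 2 * s := mul_le_mul_of_nonneg_left hsr (by positivity)
  have hkk : (k : ℝ) ≤ k * ℓ := le_mul_of_one_le_right (by positivity) hℓ1
  have hlog : k * Real.log ((d : ℝ) / k) ≤ k * ℓ :=
    mul_le_mul_of_nonneg_left (le_max_right _ _) (by positivity)
  choose! N hNcard hNT hN using fun (T : Finset (Fin d)) (hT : T.card = k) =>
    exists_net_coordinate_sphere hk T hT
  set E : (Fin d → ℝ) → Set Ω := fun v =>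
    {ω | ε / 4 * F2 ≤ |∑ i, ((X * R ω).mulVec v) i ^ 2 - F2|} with hE
  set 𝒯 := Finset.powersetCard k (Finset.univ : Finset (Fin d)) with h𝒯
  set B : Set Ω := ⋃ T ∈ 𝒯, ⋃ v ∈ N T, E v with hB
  have hBle : P.real B ≤ Real.exp (-(1 / 10 ^ 5 * ε ^ 2 * s)) := by
    set η := 2 * Real.exp (-(ε ^ 2 * s / 50000)) with hη
    have hη0 : 0 ≤ η := by positivity
    calc P.real B ≤ ∑ T ∈ 𝒯, P.real (⋃ v ∈ N T, E v) :=
          MeasureTheory.measureReal_biUnion_finset_le _ _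
      _ ≤ ∑ T ∈ 𝒯, Real.exp (18 * k) * η := by
          refine Finset.sum_le_sum fun T hT => ?_
          have hTk : T.card = k := (Finset.mem_powersetCard.1 hT).2
          calc P.real (⋃ v ∈ N T, E v) ≤ ∑ v ∈ N T, P.real (E v) :=
                MeasureTheory.measureReal_biUnion_finset_le _ _
            _ ≤ ∑ v ∈ N T, η := Finset.sum_le_sum fun v hv =>
                measureReal_fixed_vector_le hε hε1 hR hind (by nlinarith) (hNT T hTk v hv).1
            _ = (N T).card * η := by rw [Finset.sum_const, nsmul_eq_mul]
            _ ≤ _ := mul_le_mul_of_nonneg_right (hNcard T hTk) hη0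
      _ = (d.choose k : ℝ) * (Real.exp (18 * k) * η) := by
          rw [Finset.sum_const, h𝒯, Finset.card_powersetCard, Finset.card_univ, Fintype.card_fin,
            nsmul_eq_mul]
      _ ≤ Real.exp (k + k * Real.log (d / k)) *
            (Real.exp (18 * k) * (Real.exp 1 * Real.exp (-(ε ^ 2 * s / 50000)))) := by
          have : (2 : ℝ) ≤ Real.exp 1 := by linarith [Real.exp_one_gt_d9]
          rw [hη]
          gcongr
          exact choose_le_exp hk hkd
      _ ≤ _ := by
          rw [← Real.exp_add, ← Real.exp_add, ← Real.exp_add]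
          refine Real.exp_le_exp.2 ?_
          linarith
  -- Covering the whole space and using subadditivity avoids any question of measurability of the
  -- RIP event.
  have hcover : (Set.univ : Set Ω) ⊆ {ω | ProductRIP X (R ω) k ε} ∪ B := by
    intro ω _
    by_cases hω : ω ∈ B
    · exact Or.inr hω
    · refine Or.inl (productRIP_of_abs_shiftedSqNorm_le hε hε1 hkd fun T hT u hu huT => ?_)
      refine (abs_shiftedSqNorm_le_of_net (X * R ω) (m := ε / 4 * F2) (hNT T hT) (hN T hT)
        (fun v hv => ?_) hu huT).trans_eq (by ring)
      have hv1 := (hNT T hT v hv).1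
      have hvE : ω ∉ E v := fun h => hω (Set.mem_biUnion
        (Finset.mem_powersetCard.2 ⟨Finset.subset_univ _, hT⟩) (Set.mem_biUnion hv h))
      rw [shiftedSqNorm, hv1, mul_one]
      exact (not_le.1 hvE).le
  have h1 : (1 : ℝ) ≤ P.real {ω | ProductRIP X (R ω) k ε} + P.real B := by
    rw [← MeasureTheory.probReal_univ (μ := P)]
    exact (MeasureTheory.measureReal_mono hcover).trans (MeasureTheory.measureReal_union_le _ _)
  linarith
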